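/- Let $n,d\ge 0$ be integers and let $P\subset\mathbb R^n$ be a rational polytope of dimension $d$ (not necessarily simple), i.e. a nonempty convex polytope whose vertices lie in $\mathbb Q^n$ and whose affine hull has dimension $d$. Let $k\ge 2$ be a rational number. For points $x\ne y$ of $\mathbb R^n$ such that $y-x$ is a positive multiple of an integer vector, the lattice length of the segment $[x,y]$ is the ratio $\|y-x\|/\|u\|$ of Euclidean lengths, where $u\in\mathbb Z^n$ is the primitive integer vector (the one with coprime components) in the direction of $y-x$. If every edge of $P$ has lattice length at least $\tfrac12 d^2(d+1)k$, then $P$ is $k$-convex-normal, that is, for every rational number $c$ with $2\le c\le k$, $$cP=\bigcup_{v\in\operatorname{vert}(P)}\ \ \bigcup_{x\in (c-1)P\,\cap\,((c-1)v+\mathbb Z^n)}(x+P),$$ where $\operatorname{vert}(P)$ denotes the set of vertices of $P$. -/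

import Mathlib

open scoped Pointwise

/-- The integer vector `z`, seen as a point of Euclidean space `ℝⁿ`. -/
noncomputable def intPoint {n : ℕ} (z : Fin n → ℤ) : EuclideanSpace ℝ (Fin n) :=
  WithLp.toLp 2 (fun i => (z i : ℝ))

/-- The lattice `ℤⁿ` in `ℝⁿ`. -/
def integerLattice (n : ℕ) : Set (EuclideanSpace ℝ (Fin n)) :=
  Set.range (intPoint (n := n))

/-- `P` is a (nonempty, convex) polytope: the convex hull of a nonempty finite set of points. -/
def IsPolytope {n : ℕ} (P : Set (EuclideanSpace ℝ (Fin n))) : Prop :=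
  ∃ S : Set (EuclideanSpace ℝ (Fin n)), S.Finite ∧ S.Nonempty ∧ P = convexHull ℝ S

/-- The set of vertices of `P`. -/
def vert {n : ℕ} (P : Set (EuclideanSpace ℝ (Fin n))) : Set (EuclideanSpace ℝ (Fin n)) :=
  P.extremePoints ℝ

/-- A rational polytope: all coordinates of all vertices are rational. -/
def IsRationalPolytope {n : ℕ} (P : Set (EuclideanSpace ℝ (Fin n))) : Prop :=
  IsPolytope P ∧ ∀ v ∈ vert P, ∀ i, ∃ q : ℚ, v i = (q : ℝ)

/-- The dimension of `P`, that is, of its affine hull. -/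
noncomputable def polytopeDim {n : ℕ} (P : Set (EuclideanSpace ℝ (Fin n))) : ℕ :=
  Module.finrank ℝ (vectorSpan ℝ P)

/-- The segment `[x, y]` is an edge of `P`: a one-dimensional face, where a face is the set of
maximizers on `P` of a linear functional (`P` itself, from the zero functional, is a face). -/
def IsEdge {n : ℕ} (P : Set (EuclideanSpace ℝ (Fin n))) (x y : EuclideanSpace ℝ (Fin n)) :
    Prop :=
  x ≠ y ∧ IsExposed ℝ P (segment ℝ x y)

/-- `u` is the primitive integer vector (the one with coprime components) in the direction of
the vector `w`. -/
def IsPrimitiveInDirection {n : ℕ} (u : Fin n → ℤ) (w : EuclideanSpace ℝ (Fin n)) : Prop :=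
  Finset.univ.gcd u = 1 ∧ ∃ t : ℝ, 0 < t ∧ w = t • intPoint u

open Classical in
/-- The lattice length of the segment `[x, y]`: its Euclidean length divided by that of the
primitive integer vector in the direction of `y - x`. The value `0` is assigned when there is no
such vector, which never happens for `x ≠ y` with rational coordinates. -/
noncomputable def latticeLength {n : ℕ} (x y : EuclideanSpace ℝ (Fin n)) : ℝ :=
  if h : ∃ u : Fin n → ℤ, IsPrimitiveInDirection u (y - x) then
    ‖y - x‖ / ‖intPoint h.choose‖
  else 0

/-- `P` is `k`-convex-normal: for every rational `c ∈ [2, k]`, the polytope `cP` is the union of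
the translates `x + P`, where `v` runs over the vertices of `P` and `x` over the points of
`(c - 1)P ∩ ((c - 1)v + ℤⁿ)`. -/
def IsConvexNormal {n : ℕ} (k : ℚ) (P : Set (EuclideanSpace ℝ (Fin n))) : Prop :=
  ∀ c : ℚ, 2 ≤ c → c ≤ k →
    (c : ℝ) • P =
      ⋃ v ∈ vert P, ⋃ x ∈ (((c : ℝ) - 1) • P) ∩ ((((c : ℝ) - 1) • v) +ᵥ integerLattice n),
        (x +ᵥ P)

/-! ### Faces and edges of polytopes -/

section Polytope

variable {n : ℕ} {P F : Set (EuclideanSpace ℝ (Fin n))}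

/-! Only edge length `L = d(d+1)` is needed, whatever `k` is. For `d > 0`, edge directions span the
affine hull, so `d` independent edges exist; averaging segments of lattice length `L` on them puts a
unit lattice box, centred at `γb`, inside `γP`, where `γ = d/L` and `b ∈ P`. Write `A = α + β` and
`Ap = (A - 2γ)q + 2γb`. If `q ∈ P`, both summands of `Ap` can carry a box, and rounding in its
coordinates moves one into the required lattice coset and the other by the opposite error
(`Convex.exists_rounding`). If `q ∉ P`, the segment from `p` to `q` meets a proper face `F` at some
`f`, and `Ap = (A - s)f + sb` with `s ≤ 2γ`. Induction on dimension applies to `F` with `β - s`, and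
`sb` is given back to `βP`. The budget closes because `d(d+1) - 2d = (d-1)d`
(`IsPolytope.exists_vert_lattice_split`). -/

theorem IsPolytope.isCompact (hP : IsPolytope P) : IsCompact P := by
  obtain ⟨S, hS, -, rfl⟩ := hP
  exact hS.isCompact_convexHull ℝ

theorem IsPolytope.convex (hP : IsPolytope P) : Convex ℝ P := by
  obtain ⟨S, -, -, rfl⟩ := hP
  exact convex_convexHull ℝ S

theorem IsPolytope.nonempty (hP : IsPolytope P) : P.Nonempty := by
  obtain ⟨S, -, hS, rfl⟩ := hP
  exact hS.convexHull

theorem IsPolytope.finite_vert (hP : IsPolytope P) : (vert P).Finite := by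
  obtain ⟨S, hS, -, rfl⟩ := hP
  exact hS.subset extremePoints_convexHull_subset

theorem IsPolytope.vert_nonempty (hP : IsPolytope P) : (vert P).Nonempty :=
  hP.isCompact.extremePoints_nonempty hP.nonempty

/-- A nonempty exposed face of a polytope is a polytope. -/
theorem IsPolytope.of_isExposed (hP : IsPolytope P) (hF : IsExposed ℝ P F) (hne : F.Nonempty) :
    IsPolytope F := by
  have hc : IsCompact F := hF.isCompact hP.isCompact
  have hfin : (F.extremePoints ℝ).Finite :=
    hP.finite_vert.subset (hF.isExtreme.extremePoints_subset_extremePoints)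
  refine ⟨F.extremePoints ℝ, hfin, hc.extremePoints_nonempty hne, ?_⟩
  have h := closure_convexHull_extremePoints hc (hF.convex hP.convex)
  rwa [(hfin.isCompact_convexHull ℝ).isClosed.closure_eq, eq_comm] at h

/-- Exposed faces of exposed faces of a polytope are exposed. -/
theorem IsPolytope.isExposed_trans {G : Set (EuclideanSpace ℝ (Fin n))} (hP : IsPolytope P)
    (hF : IsExposed ℝ P F) (hG : IsExposed ℝ F G) : IsExposed ℝ P G := by
  intro hGne
  obtain ⟨h, rfl⟩ := hG hGne
  obtain ⟨g, hgF, hg⟩ := hGne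
  obtain ⟨l, rfl⟩ := hF ⟨g, hgF⟩
  obtain ⟨S, hS, hSne, rfl⟩ := hP
  -- `T` is large enough for `T • l` to outweigh any gain of `h` off the face `F`. Points with `l s
  -- = l g` give the quotient `0` and are handled by maximality of `g` on `F`.
  obtain ⟨s₀, hs₀, hmax⟩ := Set.exists_max_image S
    (fun s => (h s - h g) / (l g - l s)) hS hSne
  set T := max 0 ((h s₀ - h g) / (l g - l s₀)) with hT
  have key : ∀ x ∈ convexHull ℝ S, (T • l + h) x ≤ (T • l + h) g := by
    have hconv : Convex ℝ {x | (T • l + h) x ≤ (T • l + h) g} :=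
      convex_halfSpace_le (T • l + h).toLinearMap.isLinear _
    refine fun x hx => convexHull_min ?_ hconv hx
    intro s hs
    have hsP := subset_convexHull ℝ S hs
    have h1 := hgF.2 s hsP
    simp only [Set.mem_ofPred_eq, add_apply, smul_apply,
      smul_eq_mul]
    rcases h1.lt_or_eq with h2 | h2
    · have h3 := (hmax s hs).trans (le_max_right 0 _)
      rw [div_le_iff₀ (by linarith)] at h3
      linarith
    · have := hg s ⟨hsP, fun y hy => h2 ▸ hgF.2 y hy⟩
      rw [h2]; linarith
  -- With `T` alone a point outside `F` could tie with `g`; the extra `l` forces `l x = l g`.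
  refine ⟨(T + 1) • l + h, ?_⟩
  simp only [add_apply, smul_apply,
      smul_eq_mul] at key ⊢
  ext x
  constructor
  · rintro ⟨⟨hx, hxl⟩, hxh⟩
    refine ⟨hx, fun y hy => ?_⟩
    have h1 := key y hy
    have h2 := hxh g hgF
    have h3 : l x = l g := le_antisymm (hgF.2 x hx) (hxl g hgF.1)
    have h4 := hgF.2 y hy
    rw [h3]; linarith
  · rintro ⟨hx, hxm⟩
    have h1 := hxm g hgF.1
    have h2 := key x hx
    have h3 := hgF.2 x hx
    have h4 : l x = l g := by linarith
    refine ⟨⟨hx, fun y hy => h4 ▸ hgF.2 y hy⟩, fun y hy => (hg y hy).trans ?_⟩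
    rw [h4] at h1; linarith

/-- An edge of an exposed face of a polytope is an edge of the polytope. -/
theorem IsEdge.of_isExposed {x y : EuclideanSpace ℝ (Fin n)} (hP : IsPolytope P)
    (hF : IsExposed ℝ P F) (h : IsEdge F x y) : IsEdge P x y :=
  ⟨h.1, hP.isExposed_trans hF h.2⟩

/-- A linear functional that is not constant on `P` exposes a face of smaller dimension. -/
theorem polytopeDim_toExposed_lt (l : StrongDual ℝ (EuclideanSpace ℝ (Fin n)))
    (hl : ∃ u ∈ vectorSpan ℝ P, l u ≠ 0) : polytopeDim (l.toExposed P) < polytopeDim P := by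
  obtain ⟨u, hu, hlu⟩ := hl
  refine Submodule.finrank_lt_finrank_of_lt (lt_of_le_of_ne
    (vectorSpan_mono ℝ fun x hx => hx.1) fun h => hlu ?_)
  have : vectorSpan ℝ (l.toExposed P) ≤ LinearMap.ker l.toLinearMap := by
    refine Submodule.span_le.2 ?_
    rintro _ ⟨x, hx, y, hy, rfl⟩
    simp [le_antisymm (hy.2 x hx.1) (hx.2 y hy.1)]
  exact this (h ▸ hu)

/-- A linear functional that is not constant on a polytope is not constant on some edge. -/
theorem IsPolytope.exists_isEdge_ne (hP : IsPolytope P)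
    (l : StrongDual ℝ (EuclideanSpace ℝ (Fin n))) {p q : EuclideanSpace ℝ (Fin n)}
    (hp : p ∈ P) (hq : q ∈ P) (hpq : l p ≠ l q) :
    ∃ x y, IsEdge P x y ∧ l x ≠ l y := by
  induction hd : polytopeDim P using Nat.strong_induction_on generalizing P p q with
  | _ d ih =>
  obtain ⟨x, hx, hxmin⟩ := hP.isCompact.exists_isMinOn hP.nonempty l.continuous.continuousOn
  obtain ⟨y, hy, hymax⟩ := hP.isCompact.exists_isMaxOn hP.nonempty l.continuous.continuousOn
  have hmin : ∀ z ∈ P, l x ≤ l z := fun z hz => hxmin hz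
  have hmax : ∀ z ∈ P, l z ≤ l y := fun z hz => hymax hz
  have hxy : l x < l y := by
    rcases hpq.lt_or_gt with h | h
    · exact (hmin p hp).trans_lt (h.trans_le (hmax q hq))
    · exact (hmin q hq).trans_lt (h.trans_le (hmax p hp))
  by_cases hu : ∃ u ∈ vectorSpan ℝ P, u ≠ 0 ∧ l u = 0
  · obtain ⟨u, huV, hu0, hlu⟩ := hu
    obtain ⟨S, hS, hSne, rfl⟩ := hP
    set g : StrongDual ℝ (EuclideanSpace ℝ (Fin n)) := innerSL ℝ u with hg
    set P := convexHull ℝ S with hPdef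
    -- the highest value of `g` on the vertices where `l` is maximal
    have hyS : ∃ s ∈ S, l y ≤ l s := by
      by_contra! hcon
      have : P ⊆ {z | l z < l y} :=
        convexHull_min hcon (convex_halfSpace_lt l.toLinearMap.isLinear _)
      exact lt_irrefl (l y) (this hy)
    have hxS : ∃ s ∈ S, l s < l y := by
      by_contra! hcon
      have : P ⊆ {z | l y ≤ l z} :=
        convexHull_min hcon (convex_halfSpace_ge l.toLinearMap.isLinear _)
      exact hxy.not_ge (this hx)
    obtain ⟨s₁, hs₁, hs₁l⟩ := hyS
    obtain ⟨s₂, hs₂, hs₂l⟩ := hxS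
    -- In the planar shadow of `P` under `(l, g)`, `a` maps to the top of the side where `l` is
    -- maximal, and `b` to a point further along the upper boundary edge leaving it. The functional
    -- `φ` is maximal on that edge. The face it exposes is proper since `φ u = ‖u‖² ≠ 0`, and `l` is
    -- not constant on it.
    obtain ⟨a, ⟨haS, hal⟩, hamax⟩ := Set.exists_max_image {s ∈ S | l y ≤ l s} g
      (hS.subset fun s hs => hs.1) ⟨s₁, hs₁, hs₁l⟩
    obtain ⟨b, ⟨hbS, hbl⟩, hbmax⟩ := Set.exists_max_image {s ∈ S | l s < l y}
      (fun s => (g s - g a) / (l y - l s)) (hS.subset fun s hs => hs.1) ⟨s₂, hs₂, hs₂l⟩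
    have hal' : l a = l y := le_antisymm (hmax a (subset_convexHull ℝ S haS)) hal
    set t := (g b - g a) / (l y - l b) with ht
    have htb : t * (l y - l b) = g b - g a := div_mul_cancel₀ _ (by linarith)
    set φ := g + t • l with hφ
    have hφa : ∀ z ∈ P, φ z ≤ φ a := by
      refine fun z hz => convexHull_min (t := {z | φ z ≤ φ a}) ?_
        (convex_halfSpace_le φ.toLinearMap.isLinear _) hz
      intro s hs
      simp only [Set.mem_ofPred_eq, hφ, add_apply,
        smul_apply, smul_eq_mul, hal']
      rcases lt_or_ge (l s) (l y) with h | h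
      · have := hbmax s ⟨hs, h⟩
        rw [div_le_iff₀ (by linarith)] at this
        linarith
      · have h1 := hamax s ⟨hs, h⟩
        have h2 : l s = l y := le_antisymm (hmax s (subset_convexHull ℝ S hs)) h
        rw [h2]; linarith
    have hφb : φ b = φ a := by
      simp only [hφ, add_apply,
        smul_apply, smul_eq_mul, hal']
      linarith
    have hlt : polytopeDim (φ.toExposed P) < d := by
      rw [← hd]
      refine polytopeDim_toExposed_lt φ ⟨u, huV, ?_⟩
      simpa [hφ, hg, hlu] using hu0
    have haF : a ∈ φ.toExposed P := ⟨subset_convexHull ℝ S haS, hφa⟩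
    have hbF : b ∈ φ.toExposed P := ⟨subset_convexHull ℝ S hbS, fun z hz => hφb ▸ hφa z hz⟩
    have hexp : IsExposed ℝ P (φ.toExposed P) := ContinuousLinearMap.toExposed.isExposed
    have hPP : IsPolytope P := ⟨S, hS, hSne, rfl⟩
    obtain ⟨x', y', hE, hne⟩ := ih _ hlt (hPP.of_isExposed hexp ⟨a, haF⟩) haF hbF
      (by rw [hal']; exact hbl.ne') rfl
    exact ⟨x', y', hE.of_isExposed hPP hexp, hne⟩
  -- Here `l` is injective on the direction space, so `P` is itself a segment.
  · push Not at hu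
    have hseg : segment ℝ x y = P := by
      refine subset_antisymm (hP.convex.segment_subset hx hy) fun z hz => ?_
      have hd0 : 0 < l y - l x := by linarith
      set r := (l z - l x) / (l y - l x) with hr
      have hrm : r * (l y - l x) = l z - l x := div_mul_cancel₀ _ hd0.ne'
      have hz0 : (z - x) - r • (y - x) = 0 := by
        by_contra hne
        refine hu _ (Submodule.sub_mem _ (vsub_mem_vectorSpan ℝ hz hx)
          (Submodule.smul_mem _ _ (vsub_mem_vectorSpan ℝ hy hx))) hne ?_
        simp [hrm]
      rw [segment_eq_image']
      refine ⟨r, ⟨div_nonneg (by linarith [hmin z hz]) hd0.le,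
        (div_le_one hd0).2 (by linarith [hmax z hz])⟩, ?_⟩
      rw [sub_sub, sub_eq_zero] at hz0
      exact hz0.symm
    refine ⟨x, y, ⟨fun h => hxy.ne (by rw [h]), ?_⟩, hxy.ne⟩
    rw [hseg]

/-- The directions of the edges of a polytope span the direction of its affine hull. -/
theorem IsPolytope.vectorSpan_le_span_edges (hP : IsPolytope P) :
    vectorSpan ℝ P ≤ Submodule.span ℝ {w | ∃ x y, IsEdge P x y ∧ w = y - x} := by
  set W := Submodule.span ℝ {w | ∃ x y, IsEdge P x y ∧ w = y - x} with hW
  refine Submodule.span_le.2 ?_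
  rintro _ ⟨p, hp, q, hq, rfl⟩
  change p - q ∈ W
  rw [← Submodule.orthogonal_orthogonal W, Submodule.mem_orthogonal]
  intro u hu
  by_contra hne
  obtain ⟨x, y, hE, hxy⟩ := hP.exists_isEdge_ne (innerSL ℝ u) hp hq (by
    intro h; apply hne
    rw [inner_sub_right]; exact sub_eq_zero.2 h)
  refine hxy ?_
  have hw : y - x ∈ W := Submodule.subset_span ⟨x, y, hE, rfl⟩
  have := Submodule.inner_left_of_mem_orthogonal hw hu
  rw [inner_sub_right, sub_eq_zero] at this
  simpa using this.symm

end Polytope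

/-! ### Supporting functionals and exits through proper faces -/

section Support

variable {n : ℕ} {P : Set (EuclideanSpace ℝ (Fin n))}

/-- If a point `f` of a convex set `P` cannot be moved within `P` in some direction `e` of its
affine hull, then `P` has a nontrivial supporting functional at `f`. -/
theorem Convex.exists_support (hP : Convex ℝ P) {f e : EuclideanSpace ℝ (Fin n)} (hf : f ∈ P)
    (he : e ∈ vectorSpan ℝ P) (hout : ∀ ε : ℝ, 0 < ε → f + ε • e ∉ P) :
    ∃ l : StrongDual ℝ (EuclideanSpace ℝ (Fin n)),
      (∀ y ∈ P, l y ≤ l f) ∧ ∃ u ∈ vectorSpan ℝ P, l u ≠ 0 := by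
  set V := vectorSpan ℝ P with hV
  -- Inside its own direction space `P` has nonempty interior, so the separating functional is
  -- automatically nonzero on `V`.
  set Q : Set V := {u | f + (u : EuclideanSpace ℝ (Fin n)) ∈ P} with hQ
  have hQc : Convex ℝ Q := by
    intro x hx y hy a b ha hb hab
    have := hP hx hy ha hb hab
    have h : a • (f + (x : EuclideanSpace ℝ (Fin n))) + b • (f + y) = f + ((a • x + b • y : V)) := by
      have : f = (a + b) • f := by rw [hab, one_smul]
      push_cast
      nth_rw 3 [this]
      module
    rwa [h] at this
  have h0 : (0 : V) ∈ Q := by simpa [hQ] using hf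
  have hspan : Submodule.span ℝ Q = ⊤ := by
    have hle : V ≤ (Submodule.span ℝ Q).map V.subtype := by
      refine (vectorSpan_eq_span_vsub_set_right ℝ hf).le.trans (Submodule.span_le.2 ?_)
      rintro _ ⟨p, hp, rfl⟩
      refine ⟨⟨p - f, vsub_mem_vectorSpan ℝ hp hf⟩, Submodule.subset_span ?_, rfl⟩
      simpa [hQ] using hp
    refine Submodule.eq_top_iff'.2 fun u => ?_
    obtain ⟨u', hu', h⟩ := hle u.2
    rwa [← Subtype.ext h]
  have hint : (interior Q).Nonempty := by
    rw [hQc.interior_nonempty_iff_affineSpan_eq_top,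
      AffineSubspace.affineSpan_eq_top_iff_vectorSpan_eq_top_of_nonempty _ _ _ ⟨0, h0⟩,
      vectorSpan_eq_span_vsub_set_right ℝ h0]
    simpa using hspan
  have h0int : (0 : V) ∉ interior Q := by
    intro h
    have hcont : Filter.Tendsto (fun ε : ℝ => ε • (⟨e, he⟩ : V)) (nhdsWithin 0 (Set.Ioi 0))
        (nhds 0) := by
      have : Continuous fun ε : ℝ => ε • (⟨e, he⟩ : V) := by fun_prop
      simpa using (this.tendsto 0).mono_left nhdsWithin_le_nhds
    obtain ⟨ε, hε, hε0⟩ := ((hcont.eventually (mem_interior_iff_mem_nhds.1 h)).and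
      self_mem_nhdsWithin).exists
    exact hout ε hε0 hε
  obtain ⟨l, hl⟩ := geometric_hahn_banach_open_point hQc.interior isOpen_interior h0int
  obtain ⟨g, hg, -⟩ := exists_extension_norm_eq V l
  have hlQ : ∀ u ∈ Q, l u ≤ 0 := by
    intro u hu
    have hcl : u ∈ closure (interior Q) := by
      rw [hQc.closure_interior_eq_closure_of_nonempty_interior hint]
      exact subset_closure hu
    have hsub : closure (interior Q) ⊆ {u | l u ≤ 0} :=
      closure_minimal (fun a ha => by simpa using (hl a ha).le)
        (isClosed_le l.continuous continuous_const)
    exact hsub hcl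
  refine ⟨g, fun y hy => ?_, ?_⟩
  · have h1 := hlQ ⟨y - f, vsub_mem_vectorSpan ℝ hy hf⟩ (by simpa [hQ] using hy)
    rw [← hg] at h1
    simpa using h1
  · obtain ⟨a, ha⟩ := hint
    refine ⟨a, a.2, ?_⟩
    rw [hg]
    simpa using (hl a ha).ne

/-- If a segment leaves a polytope, then it meets a proper face. -/
theorem IsPolytope.exists_face_of_segment (hP : IsPolytope P) {p q : EuclideanSpace ℝ (Fin n)}
    (hp : p ∈ P) (hq : q ∉ P) (hpq : q - p ∈ vectorSpan ℝ P) :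
    ∃ T : ℝ, 0 ≤ T ∧ T < 1 ∧ ∃ F, IsExposed ℝ P F ∧ polytopeDim F < polytopeDim P ∧
      p + T • (q - p) ∈ F := by
  have hcont : Continuous fun t : ℝ => p + t • (q - p) := by fun_prop
  have hc : IsCompact (Set.Icc (0 : ℝ) 1 ∩ (fun t : ℝ => p + t • (q - p)) ⁻¹' P) :=
    isCompact_Icc.inter_right (hP.isCompact.isClosed.preimage hcont)
  obtain ⟨T, ⟨⟨hT0, hT1⟩, hTP⟩, hTmax⟩ := hc.exists_isGreatest ⟨0, by simp, by simpa using hp⟩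
  have hT1' : T < 1 := by
    refine lt_of_le_of_ne hT1 ?_
    rintro rfl
    exact hq (by simpa using hTP)
  have hout : ∀ ε : ℝ, 0 < ε → p + T • (q - p) + ε • (q - p) ∉ P := by
    intro ε hε hmem
    have hδ : 0 < min ε (1 - T) := lt_min hε (by linarith)
    have hδP : p + (T + min ε (1 - T)) • (q - p) ∈ P := by
      refine hP.convex.segment_subset hTP hmem ?_
      rw [segment_eq_image']
      refine ⟨min ε (1 - T) / ε, ⟨by positivity, (div_le_one hε).2 (min_le_left _ _)⟩, ?_⟩
      simp only [add_sub_cancel_left, smul_smul]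
      rw [div_mul_cancel₀ _ hε.ne']
      module
    have := hTmax ⟨⟨by linarith, by linarith [min_le_right ε (1 - T)]⟩, hδP⟩
    linarith
  obtain ⟨l, hl, hu⟩ := hP.convex.exists_support hTP hpq hout
  exact ⟨T, hT0, hT1', l.toExposed P, ContinuousLinearMap.toExposed.isExposed,
    polytopeDim_toExposed_lt l hu, hTP, hl⟩

end Support

/-! ### Lattice segments along edges -/

section Lattice

variable {n : ℕ}

theorem sum_zsmul_mem_integerLattice {ι : Type*} (s : Finset ι) (m : ι → ℤ)
    (u : ι → Fin n → ℤ) : ∑ i ∈ s, (m i : ℝ) • intPoint (u i) ∈ integerLattice n := by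
  refine ⟨∑ i ∈ s, m i • u i, ?_⟩
  ext j
  simp [intPoint]

/-- A segment of lattice length at least `L > 0` is a multiple, by a factor at least `L`, of an
integer vector. -/
theorem exists_intPoint_of_le_latticeLength {x y : EuclideanSpace ℝ (Fin n)} {L : ℝ} (hL : 0 < L)
    (h : L ≤ latticeLength x y) : ∃ u : Fin n → ℤ, ∃ t : ℝ, L ≤ t ∧ y - x = t • intPoint u := by
  unfold latticeLength at h
  split_ifs at h with hu
  · obtain ⟨-, t, ht, heq⟩ := hu.choose_spec
    refine ⟨hu.choose, t, h.trans ?_, heq⟩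
    have hn : ‖y - x‖ = t * ‖intPoint hu.choose‖ := by
      conv_lhs => rw [heq]
      rw [norm_smul, Real.norm_of_nonneg ht.le]
    rw [hn, mul_div_assoc]
    exact mul_le_of_le_one_right ht.le (div_self_le_one _)
  · linarith

/-- A polytope of dimension `d` all of whose edges have lattice length at least `L` has `d`
edges containing segments of lattice length `L` whose directions span its affine hull. -/
theorem IsPolytope.exists_spanning_lattice_segments {P : Set (EuclideanSpace ℝ (Fin n))}
    (hP : IsPolytope P) {L : ℝ} (hL : 0 < L)
    (hE : ∀ x y, IsEdge P x y → ∃ u : Fin n → ℤ, ∃ t : ℝ, L ≤ t ∧ y - x = t • intPoint u) :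
    ∃ (a : Fin (polytopeDim P) → EuclideanSpace ℝ (Fin n)) (u : Fin (polytopeDim P) → Fin n → ℤ),
      (∀ j, a j ∈ P ∧ a j + L • intPoint (u j) ∈ P) ∧
      vectorSpan ℝ P = Submodule.span ℝ (Set.range fun j => intPoint (u j)) := by
  set D := {w | ∃ u : Fin n → ℤ, w = intPoint u ∧ w ∈ vectorSpan ℝ P ∧
    ∃ a ∈ P, a + L • w ∈ P} with hD
  have hspan : Submodule.span ℝ D = vectorSpan ℝ P := by
    refine le_antisymm (Submodule.span_le.2 ?_) (hP.vectorSpan_le_span_edges.trans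
      (Submodule.span_le.2 ?_))
    · rintro w ⟨u, -, hw, -⟩
      exact hw
    · rintro _ ⟨x, y, hxy, rfl⟩
      obtain ⟨u, t, ht, heq⟩ := hE x y hxy
      have ht0 : 0 < t := hL.trans_le ht
      have hx : x ∈ P := hxy.2.subset (left_mem_segment ℝ x y)
      have hy : y ∈ P := hxy.2.subset (right_mem_segment ℝ x y)
      rw [heq]
      refine Submodule.smul_mem _ _ (Submodule.subset_span ⟨u, rfl, ?_, x, hx, ?_⟩)
      · have := Submodule.smul_mem _ t⁻¹ (vsub_mem_vectorSpan ℝ hy hx)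
        rwa [vsub_eq_sub, heq, smul_smul, inv_mul_cancel₀ ht0.ne', one_smul] at this
      · refine hP.convex.segment_subset hx hy ?_
        rw [segment_eq_image']
        refine ⟨L / t, ⟨by positivity, (div_le_one ht0).2 ht⟩, ?_⟩
        simp only [heq, smul_smul]
        rw [div_mul_cancel₀ _ ht0.ne']
  obtain ⟨B, hBD, hBspan, hBli⟩ := exists_linearIndependent ℝ D
  have : Fintype B := hBli.setFinite.fintype
  have hcard : Fintype.card B = polytopeDim P := by
    rw [polytopeDim, ← hspan, ← hBspan, finrank_span_set_eq_card hBli, Set.toFinset_card]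
  let eqv := (Fintype.equivFinOfCardEq hcard).symm
  have hB : ∀ w : B, ∃ u : Fin n → ℤ, (w : EuclideanSpace ℝ (Fin n)) = intPoint u ∧
      ∃ a ∈ P, a + L • (w : EuclideanSpace ℝ (Fin n)) ∈ P := fun w => by
    obtain ⟨u, hu, -, ha⟩ := hBD w.2
    exact ⟨u, hu, ha⟩
  choose u hu a ha haL using hB
  refine ⟨fun j => a (eqv j), fun j => u (eqv j), fun j => ⟨ha (eqv j), ?_⟩, ?_⟩
  · rw [← hu (eqv j)]
    exact haL (eqv j)
  · rw [← hspan, ← hBspan]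
    congr 1
    ext w
    constructor
    · intro hw
      exact ⟨eqv.symm ⟨w, hw⟩, by simp [← hu]⟩
    · rintro ⟨j, rfl⟩
      simp only [← hu (eqv j)]
      exact (eqv j).2

end Lattice

/-! ### Rounding and the covering induction -/

section Cover

variable {n : ℕ} {P : Set (EuclideanSpace ℝ (Fin n))}

/-- The average of segments `[a j, a j + L u j]` contained in a convex set is a parallelepiped
contained in this set. -/
theorem Convex.exists_box {E : Type*} [AddCommGroup E] [Module ℝ E] {P : Set E}
    (hP : Convex ℝ P) {d : ℕ} (hd : 0 < d) {L : ℝ} (hL : 0 < L) (a w : Fin d → E)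
    (h : ∀ j, a j ∈ P ∧ a j + L • w j ∈ P) :
    ∃ b ∈ P, ∀ ε : Fin d → ℝ, (∀ j, |ε j| ≤ 1 / 2) →
      ((d : ℝ) / L) • b + ∑ j, ε j • w j ∈ ((d : ℝ) / L) • P := by
  have hd0 : (0 : ℝ) < d := by exact_mod_cast hd
  have key : ∀ ε : Fin d → ℝ, (∀ j, |ε j| ≤ 1 / 2) →
      ∑ j, (1 / d : ℝ) • (a j + (L * (1 / 2 + ε j)) • w j) ∈ P := by
    intro ε hε
    refine hP.sum_mem (fun _ _ => by positivity) (by simp [hd0.ne']) fun j _ => ?_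
    refine hP.segment_subset (h j).1 (h j).2 ?_
    rw [segment_eq_image']
    have := abs_le.1 (hε j)
    refine ⟨1 / 2 + ε j, ⟨by linarith, by linarith⟩, ?_⟩
    simp only [add_sub_cancel_left, smul_smul]
    rw [mul_comm]
  -- The centre `b` is the average of the midpoints of the segments.
  refine ⟨_, key 0 (by simp), fun ε hε => ?_⟩
  refine ⟨_, key ε hε, ?_⟩
  simp only [Finset.smul_sum, ← Finset.sum_add_distrib]
  refine Finset.sum_congr rfl fun j _ => ?_
  simp only [Pi.zero_apply, smul_add, smul_smul, add_assoc, ← add_smul]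
  congr 2
  field_simp
  ring

/-- Rounding in a convex set: if the integer vectors `u j` span the affine hull of `P`, and the
parallelepiped around `γ b` spanned by the `u j` lies in `γ P`, then points of
`(α + β) P` at a distance from the boundary split as required. -/
theorem Convex.exists_rounding (hP : Convex ℝ P) {ι : Type*} [Fintype ι] (u : ι → Fin n → ℤ)
    (hu : vectorSpan ℝ P = Submodule.span ℝ (Set.range fun j => intPoint (u j)))
    {b : EuclideanSpace ℝ (Fin n)} {γ : ℝ} (hγ : 0 ≤ γ) (hb : b ∈ P)
    (hbox : ∀ ε : ι → ℝ, (∀ j, |ε j| ≤ 1 / 2) → γ • b + ∑ j, ε j • intPoint (u j) ∈ γ • P)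
    {α β : ℝ} (hα : γ ≤ α) (hβ : γ ≤ β) {q v : EuclideanSpace ℝ (Fin n)} (hq : q ∈ P)
    (hv : v ∈ P) :
    ∃ z ∈ integerLattice n, α • v + z ∈ α • P ∧
      ((α + β - 2 * γ) • q + (2 * γ) • b) - (α • v + z) ∈ β • P := by
  -- The ideal first summand is `(α - γ)q + γb`; its coordinates relative to `αv` get rounded.
  have hmem : ((α - γ) • q + γ • b) - α • v ∈ vectorSpan ℝ P := by
    have h : ((α - γ) • q + γ • b) - α • v = (α - γ) • (q - v) + γ • (b - v) := by module
    rw [h]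
    exact Submodule.add_mem _ (Submodule.smul_mem _ _ (vsub_mem_vectorSpan ℝ hq hv))
      (Submodule.smul_mem _ _ (vsub_mem_vectorSpan ℝ hb hv))
  rw [hu, Submodule.mem_span_range_iff_exists_fun] at hmem
  obtain ⟨c, hc⟩ := hmem
  have hround : ∀ δ, γ ≤ δ → ∀ ε : ι → ℝ, (∀ j, |ε j| ≤ 1 / 2) →
      (δ - γ) • q + (γ • b + ∑ j, ε j • intPoint (u j)) ∈ δ • P := by
    intro δ hδ ε hε
    have := Set.add_mem_add (Set.smul_mem_smul_set (a := δ - γ) hq) (hbox ε hε)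
    rwa [← hP.add_smul (by linarith) hγ, sub_add_cancel] at this
  have hz : ∑ j, (round (c j) : ℝ) • intPoint (u j) =
      ∑ j, c j • intPoint (u j) + ∑ j, (round (c j) - c j) • intPoint (u j) := by
    rw [← Finset.sum_add_distrib]
    exact Finset.sum_congr rfl fun j _ => by module
  refine ⟨∑ j, (round (c j) : ℝ) • intPoint (u j), sum_zsmul_mem_integerLattice _ _ _, ?_, ?_⟩
  · convert hround α hα (fun j => round (c j) - c j)
      (fun j => by rw [abs_sub_comm]; exact abs_sub_round _) using 1
    rw [hz, hc]
    module
  · convert hround β hβ (fun j => c j - round (c j)) (fun j => abs_sub_round _) using 1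
    have hneg : ∑ j, (c j - round (c j)) • intPoint (u j) =
        -∑ j, (round (c j) - c j) • intPoint (u j) := by
      rw [← Finset.sum_neg_distrib]
      exact Finset.sum_congr rfl fun j _ => by module
    rw [hz, hc, hneg]
    module

/-- If all edges of a polytope `P` of dimension `d` have lattice length at least `L`, and
`α, β ≥ d (d + 1) / L`, then every point of `(α + β) P` is in a translate `x + β P`, where `x` is
a point of `α P` that is congruent modulo `ℤⁿ` to a vertex of `α P`. -/
theorem IsPolytope.exists_vert_lattice_split {P : Set (EuclideanSpace ℝ (Fin n))}
    (hP : IsPolytope P) {L : ℝ} (hL : 0 < L)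
    (hE : ∀ x y, IsEdge P x y → ∃ u : Fin n → ℤ, ∃ t : ℝ, L ≤ t ∧ y - x = t • intPoint u)
    {α β : ℝ} (hα : (polytopeDim P : ℝ) * (polytopeDim P + 1) ≤ α * L)
    (hβ : (polytopeDim P : ℝ) * (polytopeDim P + 1) ≤ β * L)
    {p : EuclideanSpace ℝ (Fin n)} (hp : p ∈ P) :
    ∃ v ∈ vert P, ∃ z ∈ integerLattice n, α • v + z ∈ α • P ∧
      (α + β) • p - (α • v + z) ∈ β • P := by
  induction hd : polytopeDim P using Nat.strong_induction_on generalizing P β p with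
  | _ d ih =>
  rw [hd] at hα hβ
  obtain ⟨v, hv⟩ := hP.vert_nonempty
  rcases Nat.eq_zero_or_pos d with rfl | hdpos
  · have hpv : p = v := by
      have : vectorSpan ℝ P = ⊥ := Submodule.finrank_eq_zero.1 hd
      have h := vsub_mem_vectorSpan ℝ hp hv.1
      rw [this] at h
      exact sub_eq_zero.1 h
    refine ⟨v, hv, 0, ⟨0, by ext; simp [intPoint]⟩, ?_, ?_⟩
    · rw [add_zero]
      exact Set.smul_mem_smul_set hv.1
    · rw [hpv, add_zero, add_smul, add_sub_cancel_left]
      exact Set.smul_mem_smul_set hv.1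
  have hd1 : (1 : ℝ) ≤ d := by exact_mod_cast hdpos
  obtain ⟨a, u, hau, hspan⟩ := hP.exists_spanning_lattice_segments hL hE
  obtain ⟨b, hb, hbox⟩ := hP.convex.exists_box (hd ▸ hdpos) hL a (fun j => intPoint (u j)) hau
  set γ : ℝ := polytopeDim P / L with hγ
  have hγL : γ * L = d := by rw [hγ, div_mul_cancel₀ _ hL.ne', hd]
  have hγ0 : 0 < γ := by rw [hγ, hd]; positivity
  -- Uses `2d ≤ d(d+1)`, valid as `d ≥ 1`.
  have hγα : 2 * γ ≤ α := by
    refine le_of_mul_le_mul_right ?_ hL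
    nlinarith
  have hγβ : 2 * γ ≤ β := by
    refine le_of_mul_le_mul_right ?_ hL
    nlinarith
  set A := α + β with hA
  have hA0 : 0 < A - 2 * γ := by linarith
  -- the point `q` of which `A p` is a contraction towards `b`
  set q := (A / (A - 2 * γ)) • p - (2 * γ / (A - 2 * γ)) • b with hq
  have hpq : A • p = (A - 2 * γ) • q + (2 * γ) • b := by
    rw [hq, smul_sub, smul_smul, smul_smul, mul_div_cancel₀ _ hA0.ne', mul_div_cancel₀ _ hA0.ne']
    module
  by_cases hqP : q ∈ P
  · obtain ⟨z, hz, h1, h2⟩ := hP.convex.exists_rounding u hspan hγ0.le hb hbox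
      (by linarith : γ ≤ α) (by linarith : γ ≤ β) hqP hv.1
    exact ⟨v, hv, z, hz, h1, by rw [hpq]; exact h2⟩
  · have hqp : q - p = (2 * γ / (A - 2 * γ)) • (p - b) := by
      have : A / (A - 2 * γ) = 1 + 2 * γ / (A - 2 * γ) := by field_simp; ring
      rw [hq, this]
      module
    obtain ⟨T, hT0, hT1, F, hF, hFd, hfF⟩ := hP.exists_face_of_segment hp hqP (by
      rw [hqp]
      exact Submodule.smul_mem _ _ (vsub_mem_vectorSpan ℝ hp hb))
    set f := p + T • (q - p) with hf
    set r := 1 + T * (2 * γ / (A - 2 * γ)) with hr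
    have hr1 : 1 ≤ r := by
      have : 0 ≤ T * (2 * γ / (A - 2 * γ)) := by positivity
      linarith
    -- `A p = (A - s) f + s b`
    set s := A - A / r with hs
    have hs0 : 0 ≤ s := by
      have : A / r ≤ A := div_le_self (by linarith) hr1
      linarith
    have hs2 : s ≤ 2 * γ := by
      have h1 : r ≤ A / (A - 2 * γ) := by
        have : A / (A - 2 * γ) = 1 + 2 * γ / (A - 2 * γ) := by field_simp; ring
        rw [this, hr]
        have : T * (2 * γ / (A - 2 * γ)) ≤ 1 * (2 * γ / (A - 2 * γ)) := by gcongr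
        linarith
      rw [le_div_iff₀ hA0] at h1
      have : A - 2 * γ ≤ A / r := by
        rw [le_div_iff₀ (by linarith)]
        linarith
      linarith
    have hps : A • p = (A - s) • f + s • b := by
      have hfr : f = r • p - (r - 1) • b := by
        rw [hf, hqp, hr]
        module
      have h1 : (A - s) * r = A := by
        rw [hs, sub_sub_cancel, div_mul_cancel₀ _ (by linarith)]
      have h2 : (A - s) * (r - 1) = s := by linarith
      rw [hfr, smul_sub, smul_smul, smul_smul, h1, h2, sub_add_cancel]
    have hdF : (polytopeDim F : ℝ) + 1 ≤ d := by
      rw [← hd]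
      exact_mod_cast hFd
    have hmono : (polytopeDim F : ℝ) * (polytopeDim F + 1) ≤ (d - 1) * d := by
      gcongr
      linarith
    -- Passing to `F` costs at most `2d` of the budget `βL`.
    have hsL : s * L ≤ 2 * d := by
      have : s * L ≤ 2 * γ * L := by gcongr
      linarith
    have hα' : (polytopeDim F : ℝ) * (polytopeDim F + 1) ≤ α * L := by linarith
    have hβ' : (polytopeDim F : ℝ) * (polytopeDim F + 1) ≤ (β - s) * L := by linarith
    obtain ⟨v', hv', z, hz, h1, h2⟩ := ih _ (hd ▸ hFd) (hP.of_isExposed hF ⟨f, hfF⟩)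
      (fun x y hxy => hE x y (hxy.of_isExposed hP hF)) hα' hβ' hfF rfl
    refine ⟨v', hF.isExtreme.extremePoints_subset_extremePoints hv', z, hz,
      Set.smul_set_mono hF.subset h1, ?_⟩
    -- `(β - s)P + sP = βP` absorbs the term `sb`.
    have h3 := Set.add_mem_add (Set.smul_set_mono hF.subset h2)
      (Set.smul_mem_smul_set (a := s) hb)
    rw [← hP.convex.add_smul (by linarith) hs0, sub_add_cancel] at h3
    convert h3 using 1
    rw [hps, hA]
    module

end Cover

theorem theorem1p2 (n d : ℕ) (k : ℚ) (hk : 2 ≤ k)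
    (P : Set (EuclideanSpace ℝ (Fin n))) (hP : IsRationalPolytope P) (hd : polytopeDim P = d)
    (hE : ∀ x y : EuclideanSpace ℝ (Fin n), IsEdge P x y →
      (1 / 2 : ℝ) * (d : ℝ) ^ 2 * ((d : ℝ) + 1) * (k : ℝ) ≤ latticeLength x y) :
    IsConvexNormal k P := by
  intro c hc hck
  obtain ⟨hP, -⟩ := hP
  have hk' : (2 : ℝ) ≤ k := by exact_mod_cast hk
  have hc' : (2 : ℝ) ≤ c := by exact_mod_cast hc
  -- the edges have lattice length at least `L`
  obtain ⟨L, hL, hdL, hEL⟩ : ∃ L : ℝ, 0 < L ∧ (d : ℝ) * (d + 1) ≤ L ∧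
      ∀ x y, IsEdge P x y → ∃ u : Fin n → ℤ, ∃ t : ℝ, L ≤ t ∧ y - x = t • intPoint u := by
    rcases Nat.eq_zero_or_pos d with rfl | hdpos
    -- A point has no edges, so any positive `L` serves.
    · refine ⟨1, one_pos, by simp, fun x y hxy => absurd ?_ hxy.1⟩
      have h := vsub_mem_vectorSpan ℝ (hxy.2.subset (left_mem_segment ℝ x y))
        (hxy.2.subset (right_mem_segment ℝ x y))
      rw [Submodule.finrank_eq_zero.1 hd] at h
      exact sub_eq_zero.1 h
    · have hd1 : (1 : ℝ) ≤ d := by exact_mod_cast hdpos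
      refine ⟨d * (d + 1), by positivity, le_rfl, fun x y hxy =>
        exists_intPoint_of_le_latticeLength (by positivity) (le_trans ?_ (hE x y hxy))⟩
      calc (d : ℝ) * (d + 1) = 1 / 2 * (d * 1) * (d + 1) * 2 := by ring
        _ ≤ 1 / 2 * (d * d) * (d + 1) * k := by gcongr
        _ = 1 / 2 * (d : ℝ) ^ 2 * (d + 1) * k := by ring
  refine subset_antisymm ?_ ?_
  · rintro _ ⟨p, hp, rfl⟩
    -- Both scales are at least `1` because `c ≥ 2`.
    obtain ⟨v, hv, z, hz, h1, h2⟩ := hP.exists_vert_lattice_split hL hEL (α := c - 1) (β := 1)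
      (by rw [hd]; nlinarith) (by rw [hd]; linarith) hp
    rw [sub_add_cancel, one_smul] at h2
    simp only [Set.mem_iUnion]
    exact ⟨v, hv, _, ⟨h1, z, hz, rfl⟩, _, h2, by simp⟩
  · simp only [Set.iUnion_subset_iff]
    rintro v hv x ⟨hx, -⟩ _ ⟨p, hp, rfl⟩
    have h := Set.add_mem_add hx (Set.smul_mem_smul_set (a := (1 : ℝ)) hp)
    rwa [← hP.convex.add_smul (by linarith) zero_le_one, sub_add_cancel, one_smul] at h
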